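/- All graphs are finite and simple. A set $S\subseteq V(G)$ is a connected dominating set of $G$ if every vertex outside $S$ has a neighbour in $S$ and $G[S]$ is connected. Two disjoint sets $A,B\subseteq V(G)$ form a connected coalition of $G$ if $A\cup B$ is a connected dominating set of $G$ but neither $A$ nor $B$ is. A connected coalition partition of $G$ is a partition $\Phi$ of $V(G)$ into nonempty sets such that each $A\in\Phi$ either is $\{v\}$ for a vertex $v$ of degree $|V(G)|-1$, or forms a connected coalition of $G$ with another set $B\in\Phi$. The connected coalition number $CC(G)$ is the largest number of sets in a connected coalition partition of $G$, and $CC(G)=0$ if there is none. Let $\mathcal{G}$ be the family of all graphs (up to isomorphism) obtained by identifying a vertex of the triangle $K_3$ with the center of a star $K_{1,k}$, $k\ge 1$. **Theorem.** Let $G$ be a unicyclic graph of order $n$, that is, a connected graph that contains exactly one cycle $C_m$, and let $Y=\{v\in V(C_m)\mid G-v \text{ is connected}\}$. Then $$CC(G)=\begin{cases}4, & \text{if } G\cong C_4,\\ 0, & \text{if } G\in\mathcal{G},\\ 2, & \text{if } G\notin\mathcal{G},\ n\ge 5, \text{ and either } |Y|\le 1 \text{ or } G[Y]\cong K_2,\\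 3, & \text{otherwise.}\end{cases}$$ -/

import Mathlib

namespace ConnectedCoalition

/-- `S` is a dominating set of `G`: every vertex outside `S` has a neighbour in `S`. -/
def IsDominatingSet {V : Type*} (G : SimpleGraph V) (S : Finset V) : Prop :=
  ∀ v, v ∉ S → ∃ u ∈ S, G.Adj u v

/-- `S` is a connected dominating set of `G`: it is dominating and `G[S]` is connected. -/
def IsConnectedDominatingSet {V : Type*} (G : SimpleGraph V) (S : Finset V) : Prop :=
  IsDominatingSet G S ∧ (G.induce (S : Set V)).Connected

/-- The disjoint sets `A` and `B` form a connected coalition of `G`. -/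
def IsConnectedCoalition {V : Type*} [DecidableEq V] (G : SimpleGraph V) (A B : Finset V) : Prop :=
  Disjoint A B ∧ IsConnectedDominatingSet G (A ∪ B) ∧
    ¬ IsConnectedDominatingSet G A ∧ ¬ IsConnectedDominatingSet G B

/-- A full vertex is a vertex of degree `|V(G)| - 1`. -/
def IsFullVertex {V : Type*} [Fintype V] (G : SimpleGraph V) [DecidableRel G.Adj] (v : V) : Prop :=
  G.degree v = Fintype.card V - 1

/-- A partition of `V(G)` (into nonempty sets) is a connected coalition partition if each of its
sets is the singleton of a full vertex, or forms a connected coalition with another of its sets. -/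
def IsConnectedCoalitionPartition {V : Type*} [Fintype V] [DecidableEq V] (G : SimpleGraph V)
    [DecidableRel G.Adj] (P : Finpartition (Finset.univ : Finset V)) : Prop :=
  ∀ A ∈ P.parts, (∃ v, IsFullVertex G v ∧ A = {v}) ∨
    ∃ B ∈ P.parts, B ≠ A ∧ IsConnectedCoalition G A B

/-- The connected coalition number `CC(G)`: the largest size of a connected coalition partition,
and `0` if there is none. The set of sizes is bounded by the order of `G`, and `sSup ∅ = 0`. -/
noncomputable def CC {V : Type*} [Fintype V] [DecidableEq V] (G : SimpleGraph V)
    [DecidableRel G.Adj] : ℕ :=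
  sSup {k : ℕ | ∃ P : Finpartition (Finset.univ : Finset V),
    IsConnectedCoalitionPartition G P ∧ P.parts.card = k}

/-- The subgraph `C` of `G` is a cycle, i.e. it consists of the vertices and edges of a closed walk
of positive length without repeated edges, and without repeated vertices apart from its ends. -/
def IsCycleSubgraph {V : Type*} {G : SimpleGraph V} (C : G.Subgraph) : Prop :=
  ∃ (u : V) (p : G.Walk u u), p.IsCycle ∧ p.toSubgraph = C

/-- `G` is unicyclic with cycle `C`: it is connected and `C` is the one and only cycle in it. -/
def IsUnicyclicWith {V : Type*} (G : SimpleGraph V) (C : G.Subgraph) : Prop :=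
  G.Connected ∧ IsCycleSubgraph C ∧ ∀ C' : G.Subgraph, IsCycleSubgraph C' → C' = C

/-- The triangle `K₃` and the star `K_{1,k}` (with center `none`), glued by identifying the
vertex `0` of `K₃` with the center of the star. -/
def triangleWithStar (k : ℕ) : SimpleGraph (Fin 3 ⊕ Fin k) :=
  (⊤ : SimpleGraph (Fin 3)).map Sum.inl ⊔
    (SimpleGraph.starGraph (none : Option (Fin k))).map (fun x => x.elim (Sum.inl 0) Sum.inr)

/-- `G` belongs to the family of triangles with a star (with at least one edge) glued at a vertex,
up to isomorphism. -/
def IsTriangleWithStar {V : Type*} (G : SimpleGraph V) : Prop :=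
  ∃ k : ℕ, 1 ≤ k ∧ Nonempty (G ≃g triangleWithStar k)

/-- The set of vertices `v` of the cycle `C` such that `G - v` is connected. -/
def nonCutCycleVertices {V : Type*} (G : SimpleGraph V) (C : G.Subgraph) : Set V :=
  {v | v ∈ C.verts ∧ (G.induce ({v}ᶜ : Set V)).Connected}

/-- The exceptional condition `|Y| ≤ 1` or `G[Y] = K₂`. -/
def AtMostOneOrEdge {V : Type*} (G : SimpleGraph V) (Y : Set V) : Prop :=
  Y.ncard ≤ 1 ∨ Nonempty (G.induce Y ≃g (⊤ : SimpleGraph (Fin 2)))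

end ConnectedCoalition

/-!
Let `G` be unicyclic with cycle `C`, of order at least four. Everything rests on a description of
the connected dominating sets: `S` is one if and only if no cut vertex is outside `S` and the
vertices of `C` outside `S` are pairwise adjacent (`IsConnectedDominatingSet.isNonCut`,
`IsUnicyclicWith.adj_of_notMem`, and the converse `IsUnicyclicWith.isConnectedDominatingSet`).
The uniqueness of `C` enters through `IsUnicyclicWith.cycle_through`: a path between two neighbours
of `x` that avoids `x` closes up to a cycle, so it runs through all other vertices of `C`. Hence a
non-cut vertex has degree at most two and is a leaf or on `C`, and no three non-cut vertices form a
triangle (`IsUnicyclicWith.not_isNonCut_triangle`).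

A full vertex occurs only in a triangle with a star, whose pendant vertices prevent any connected
coalition partition. Suppose there is none, and the order is at least five.

* Lower bounds: two nonadjacent non-cut vertices `y`, `z` of `C` give the partition into `{y}`,
  `{z}` and the rest, since the rest is not a connected dominating set but becomes one with either
  vertex. If the set `Y` of non-cut vertices of `C` is a clique, there is a cut vertex `c`, and
  `{c}` and its complement form a coalition.
* Upper bounds: if there is a cut vertex and there are at least three parts, the part `A` that
  contains it takes part in all coalitions. Hence every vertex outside `A` is outside some
  connected dominating set, so it is not a cut vertex. As `A` is not a connected dominating set, two
  nonadjacent vertices of `Y` are outside `A`, and each other part contains one of them. So there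
  are at most three parts, and at most two if `Y` is a clique. If there is no cut vertex, every
  connected dominating set misses at most two vertices, and four parts lead to three pairwise
  adjacent vertices.

The condition on `Y` in the theorem says that `Y` is a clique, because `Y` contains no triangle
(`IsUnicyclicWith.atMostOneOrEdge_iff`). The orders three and four leave only the triangle, the
cycle of length four and the triangle with one pendant edge.
-/

namespace ConnectedCoalition

open SimpleGraph

/-! ### The unique cycle -/

/-- The vertex `v` is not a cut vertex of `G`: deleting it leaves a connected graph. -/
def IsNonCut {V : Type*} (G : SimpleGraph V) (v : V) : Prop :=
  (G.induce ({v}ᶜ : Set V)).Connected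

section Cycle

variable {V : Type*} {G : SimpleGraph V} {C : G.Subgraph}

lemma IsCycleSubgraph.exists_two_adj (hC : IsCycleSubgraph C) {x : V}
    (hx : x ∈ C.verts) :
    ∃ a b, a ≠ b ∧ G.Adj x a ∧ G.Adj x b ∧ a ∈ C.verts ∧ b ∈ C.verts := by
  obtain ⟨u, p, hp, rfl⟩ := hC
  have h2 := hp.ncard_neighborSet_toSubgraph_eq_two ((Walk.mem_verts_toSubgraph p).1 hx)
  obtain ⟨a, b, hab, hN⟩ := Set.ncard_eq_two.1 h2
  have ha : p.toSubgraph.Adj x a := by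
    change a ∈ p.toSubgraph.neighborSet x
    simp [hN]
  have hb : p.toSubgraph.Adj x b := by
    change b ∈ p.toSubgraph.neighborSet x
    simp [hN]
  exact ⟨a, b, hab, ha.adj_sub, hb.adj_sub, ha.snd_mem, hb.snd_mem⟩

lemma IsCycleSubgraph.nonempty (hC : IsCycleSubgraph C) : C.verts.Nonempty := by
  obtain ⟨u, p, -, rfl⟩ := hC
  exact ⟨u, p.start_mem_verts_toSubgraph⟩

lemma exists_isPath_of_preconnected_induce {S : Set V} (hS : (G.induce S).Preconnected) {a b : V}
    (ha : a ∈ S) (hb : b ∈ S) : ∃ q : G.Walk a b, q.IsPath ∧ ∀ w ∈ q.support, w ∈ S := by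
  classical
  obtain ⟨q⟩ := hS ⟨a, ha⟩ ⟨b, hb⟩
  let f : G.induce S →g G := (Embedding.induce S).toHom
  let q' : G.Walk a b := q.map f
  refine ⟨q'.bypass, q'.bypass_isPath, fun w hw => ?_⟩
  have hw' : w ∈ (q.map f).support := q'.support_bypass_subset_support hw
  rw [Walk.support_map, List.mem_map] at hw'
  obtain ⟨z, -, rfl⟩ := hw'
  exact z.2

/-- A path between two neighbours of `x` closes up through `x` to a cycle, which has to be `C`.
This is the only way in which the uniqueness of the cycle is used. -/
lemma IsUnicyclicWith.cycle_through (hG : IsUnicyclicWith G C) {S : Set V}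
    (hS : (G.induce S).Preconnected) {x a b : V} (hx : x ∉ S) (ha : a ∈ S) (hb : b ∈ S)
    (hab : a ≠ b) (hxa : G.Adj x a) (hxb : G.Adj x b) :
    C.verts ⊆ insert x S ∧ x ∈ C.verts ∧ C.Adj x a ∧ ∀ c, C.Adj x c → c = a ∨ c = b := by
  obtain ⟨q, hq, hqS⟩ := exists_isPath_of_preconnected_induce hS ha hb
  have hxq : x ∉ q.support := fun h => hx (hqS x h)
  have hcyc : (Walk.cons hxa (q.concat hxb.symm)).IsCycle := by
    rw [Walk.cons_isCycle_iff]
    refine ⟨hq.concat hxq _, fun h => ?_⟩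
    rw [Walk.edges_concat, List.concat_eq_append, List.mem_append] at h
    rcases h with h | h
    · exact hxq (q.fst_mem_support_of_mem_edges h)
    · simp only [List.mem_singleton, Sym2.eq_iff] at h
      grind
  have hCeq := hG.2.2 _ ⟨x, _, hcyc, rfl⟩
  have hadj : ∀ c, C.Adj x c ↔ s(x, c) ∈ (Walk.cons hxa (q.concat hxb.symm)).edges := by
    intro c
    rw [← hCeq, ← Walk.mem_edges_toSubgraph, Subgraph.mem_edgeSet]
  refine ⟨fun w hw => ?_, ?_, ?_, fun c hc => ?_⟩
  · rw [← hCeq, Walk.mem_verts_toSubgraph, Walk.support_cons, Walk.support_concat] at hw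
    simp only [List.mem_cons, List.mem_append, List.not_mem_nil, or_false] at hw
    rcases hw with h | h | h
    · exact Or.inl h
    · exact Or.inr (hqS w h)
    · exact Or.inl h
  · rw [← hCeq]
    exact Walk.start_mem_verts_toSubgraph _
  · rw [hadj]
    simp
  · rw [hadj, Walk.edges_cons, Walk.edges_concat, List.concat_eq_append, List.mem_cons,
      List.mem_append] at hc
    rcases hc with h | h | h
    · rw [Sym2.eq_iff] at h
      grind
    · exact absurd (q.fst_mem_support_of_mem_edges h) hxq
    · simp only [List.mem_singleton, Sym2.eq_iff] at h
      grind

/-- A vertex that is neither a cut vertex nor a leaf lies on the cycle. -/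
lemma IsUnicyclicWith.mem_cycle_of_isNonCut (hG : IsUnicyclicWith G C) {x a b : V}
    (hx : IsNonCut G x) (hab : a ≠ b) (hxa : G.Adj x a) (hxb : G.Adj x b) : x ∈ C.verts :=
  (hG.cycle_through hx.preconnected (by simp) (by simpa using hxa.ne') (by simpa using hxb.ne')
    hab hxa hxb).2.1

/-- A vertex that is not a cut vertex has degree at most two: with three neighbours it would lie
on two different cycles. -/
lemma IsUnicyclicWith.eq_or_eq_of_isNonCut (hG : IsUnicyclicWith G C) {x a b c : V}
    (hx : IsNonCut G x) (hab : a ≠ b) (hxa : G.Adj x a) (hxb : G.Adj x b) (hxc : G.Adj x c) :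
    c = a ∨ c = b := by
  by_contra! h
  have h1 := hG.cycle_through hx.preconnected (by simp) (by simpa using hxa.ne')
    (by simpa using hxb.ne') hab hxa hxb
  have h2 := hG.cycle_through hx.preconnected (by simp) (by simpa using hxc.ne')
    (by simpa using hxb.ne') h.2 hxc hxb
  rcases h1.2.2.2 c h2.2.2.1 with h' | h'
  · exact h.1 h'
  · exact h.2 h'

/-- A triangle is the cycle. -/
lemma IsUnicyclicWith.cycle_subset_triangle (hG : IsUnicyclicWith G C) {x a b : V}
    (hxa : G.Adj x a) (hxb : G.Adj x b) (hab : G.Adj a b) : C.verts ⊆ {x, a, b} :=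
  (hG.cycle_through (induce_pair_connected_of_adj hab).preconnected
    (by simp [hxa.ne, hxb.ne]) (by simp) (by simp) hab.ne hxa hxb).1

lemma eq_univ_of_closed (hG : G.Connected) {S : Set V} (hne : S.Nonempty)
    (hS : ∀ x ∈ S, ∀ y, G.Adj x y → y ∈ S) (v : V) : v ∈ S := by
  obtain ⟨u, hu⟩ := hne
  obtain ⟨p⟩ := hG.preconnected u v
  induction p with
  | nil => exact hu
  | cons h p ih => exact ih (hS _ hu _ h)

lemma exists_notMem_triple [Fintype V] (h4 : 4 ≤ Fintype.card V) (x a b : V) :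
    ∃ d, d ≠ x ∧ d ≠ a ∧ d ≠ b := by
  classical
  by_contra! h
  have : (Finset.univ : Finset V) ⊆ {x, a, b} := by
    intro d _
    simp only [Finset.mem_insert, Finset.mem_singleton]
    by_contra! h'
    exact h'.2.2 (h d h'.1 h'.2.1)
  have := Finset.card_le_card this
  have h3 : ({x, a, b} : Finset V).card ≤ 3 := Finset.card_le_three
  rw [Finset.card_univ] at this
  omega

/-- The vertices of a triangle cannot all fail to be cut vertices, unless there is no other
vertex. -/
lemma IsUnicyclicWith.not_isNonCut_triangle [Fintype V] (hG : IsUnicyclicWith G C)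
    (h4 : 4 ≤ Fintype.card V) {x a b : V} (hxa : G.Adj x a) (hxb : G.Adj x b) (hab : G.Adj a b)
    (hx : IsNonCut G x) (ha : IsNonCut G a) (hb : IsNonCut G b) : False := by
  obtain ⟨d, hdx, hda, hdb⟩ := exists_notMem_triple h4 x a b
  have : d ∈ ({x, a, b} : Set V) := by
    refine eq_univ_of_closed hG.1 ⟨x, by simp⟩ ?_ d
    rintro w (rfl | rfl | rfl) y hy
    · have := hG.eq_or_eq_of_isNonCut hx hab.ne hxa hxb hy
      simp [this]
    · rcases hG.eq_or_eq_of_isNonCut ha hxb.ne hxa.symm hab hy with h | h <;> simp [h]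
    · rcases hG.eq_or_eq_of_isNonCut hb hxa.ne hxb.symm hab.symm hy with h | h <;> simp [h]
  simp [hdx, hda, hdb] at this

/-- A neighbour of a non-cut vertex is not a leaf. -/
lemma IsNonCut.exists_adj_ne [Fintype V] (h3 : 3 ≤ Fintype.card V) {u w : V}
    (hu : IsNonCut G u) (huw : G.Adj w u) : ∃ t, t ≠ u ∧ G.Adj w t := by
  obtain ⟨t, htw, htu⟩ : ∃ t, t ≠ w ∧ t ≠ u := by
    classical
    by_contra! h
    have : (Finset.univ : Finset V) ⊆ {w, u} := by
      intro d _
      simp only [Finset.mem_insert, Finset.mem_singleton]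
      by_contra! h'
      exact h'.2 (h d h'.1)
    have := Finset.card_le_card this
    have h2 : ({w, u} : Finset V).card ≤ 2 := Finset.card_le_two
    rw [Finset.card_univ] at this
    omega
  obtain ⟨q, -, hqS⟩ := exists_isPath_of_preconnected_induce hu.preconnected
    (a := w) (b := t) (by simpa using huw.ne) (by simpa using htu)
  cases q with
  | nil => exact absurd rfl htw
  | cons h q => exact ⟨_, by simpa using hqS _ (by simp), h⟩

/-- If a non-cut vertex has a neighbour that is not a cut vertex either, it lies on the cycle. -/
lemma IsUnicyclicWith.mem_cycle_of_isNonCut_of_adj [Fintype V] (hG : IsUnicyclicWith G C)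
    (h3 : 3 ≤ Fintype.card V) {u w : V} (hw : IsNonCut G w) (hu : IsNonCut G u)
    (huw : G.Adj w u) : w ∈ C.verts := by
  obtain ⟨t, htu, hwt⟩ := hu.exists_adj_ne h3 huw
  exact hG.mem_cycle_of_isNonCut hw htu hwt huw

end Cycle

/-! ### Connected dominating sets of unicyclic graphs -/

section Dominating

variable {V : Type*} {G : SimpleGraph V} {C : G.Subgraph}

lemma IsConnectedDominatingSet.mono {S T : Finset V} (hS : IsConnectedDominatingSet G S)
    (hST : S ⊆ T) : IsConnectedDominatingSet G T := by
  refine ⟨fun v hv => ?_, ?_⟩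
  · obtain ⟨u, hu, huv⟩ := hS.1 v (fun h => hv (hST h))
    exact ⟨u, hST hu, huv⟩
  · obtain ⟨⟨u, hu⟩⟩ := hS.2.nonempty
    refine induce_connected_of_patches u (hST hu) fun {v} hv => ?_
    by_cases hvS : v ∈ S
    · exact ⟨S, Finset.coe_subset.2 hST, hu, hvS, hS.2.preconnected _ _⟩
    · obtain ⟨w, hw, hwv⟩ := hS.1 v hvS
      have hconn : (G.induce ((S : Set V) ∪ {v})).Connected :=
        connected_induce_union hS.2.preconnected Preconnected.of_subsingleton hw
          (Set.mem_singleton v) hwv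
      refine ⟨(S : Set V) ∪ {v}, ?_, Or.inl hu, Or.inr rfl, hconn.preconnected _ _⟩
      rintro z (hz | rfl)
      · exact hST hz
      · exact hv

/-- If every vertex of `T` outside `R` has at most one neighbour in `T`, then a path inside `T`
with both ends in `R` stays in `R`. -/
lemma preconnected_induce_of_leaves {T R : Set V} (hT : (G.induce T).Preconnected) (hRT : R ⊆ T)
    (hleaf : ∀ w ∈ T, w ∉ R → ∀ a ∈ T, ∀ b ∈ T, G.Adj w a → G.Adj w b → a = b) :
    (G.induce R).Preconnected := by
  rintro ⟨a, ha⟩ ⟨b, hb⟩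
  obtain ⟨q, hq, hqT⟩ := exists_isPath_of_preconnected_induce hT (hRT ha) (hRT hb)
  refine ⟨q.induce R fun w hw => ?_⟩
  by_contra hwR
  obtain ⟨i, rfl, hi⟩ := Walk.mem_support_iff_exists_getVert.1 hw
  have hi0 : i ≠ 0 := by rintro rfl; exact hwR (by simpa using ha)
  have hil : i ≠ q.length := by rintro rfl; exact hwR (by simpa using hb)
  have h1 : G.Adj (q.getVert i) (q.getVert (i - 1)) := by
    have := q.adj_getVert_succ (i := i - 1) (by omega)
    rw [Nat.sub_add_cancel (by omega)] at this
    exact this.symm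
  have h2 : G.Adj (q.getVert i) (q.getVert (i + 1)) := q.adj_getVert_succ (by omega)
  have := hleaf _ (hqT _ hw) hwR _ (hqT _ (q.getVert_mem_support _)) _
    (hqT _ (q.getVert_mem_support _)) h1 h2
  have := hq.getVert_injOn (by simp; omega) (by simp; omega) this
  omega

variable [Fintype V] [DecidableEq V]

lemma IsConnectedDominatingSet.isNonCut {S : Finset V} (hS : IsConnectedDominatingSet G S) {v : V}
    (hv : v ∉ S) : IsNonCut G v := by
  have := (hS.mono (T := {v}ᶜ) (by intro w hw; simp; rintro rfl; exact hv hw)).2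
  rwa [Finset.coe_compl, Finset.coe_singleton] at this

/-- Two cycle vertices outside a connected dominating set are adjacent. Otherwise the two
neighbours of the one on the cycle would be joined by a path that avoids both, which gives a cycle
that misses the other. -/
lemma IsUnicyclicWith.adj_of_notMem (hG : IsUnicyclicWith G C) {S : Finset V}
    (hS : IsConnectedDominatingSet G S) {x y : V} (hx : x ∉ S) (hy : y ∉ S) (hxC : x ∈ C.verts)
    (hyC : y ∈ C.verts) (hxy : x ≠ y) : G.Adj x y := by
  by_contra hadj
  obtain ⟨a, b, hab, hxa, hxb, -, -⟩ := hG.2.1.exists_two_adj hxC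
  have hT := (hS.mono (T := {x, y}ᶜ) (by
    intro w hw
    simp only [Finset.mem_compl, Finset.mem_insert, Finset.mem_singleton, not_or]
    exact ⟨by rintro rfl; exact hx hw, by rintro rfl; exact hy hw⟩)).2
  have hmem : ∀ w, w ∈ ((({x, y}ᶜ : Finset V)) : Set V) ↔ w ≠ x ∧ w ≠ y := by simp [and_comm]
  have hay : a ≠ y := by rintro rfl; exact hadj hxa
  have hby : b ≠ y := by rintro rfl; exact hadj hxb
  have := (hG.cycle_through hT.preconnected (by simp) ((hmem a).2 ⟨hxa.ne', hay⟩)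
    ((hmem b).2 ⟨hxb.ne', hby⟩) hab hxa hxb).1 hyC
  rcases this with h | h
  · exact hxy h.symm
  · exact ((hmem y).1 h).2 rfl

/-- Sufficient condition for a connected dominating set: all missing vertices are non-cut vertices,
and the missing cycle vertices are pairwise adjacent. -/
lemma IsUnicyclicWith.isConnectedDominatingSet (hG : IsUnicyclicWith G C)
    (h4 : 4 ≤ Fintype.card V) {S : Finset V} (hcut : ∀ v, v ∉ S → IsNonCut G v)
    (hclique : ∀ x ∈ C.verts, ∀ y ∈ C.verts, x ∉ S → y ∉ S → x ≠ y → G.Adj x y) :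
    IsConnectedDominatingSet G S := by
  have hdom : IsDominatingSet G S := by
    intro w hw
    by_cases hwC : w ∈ C.verts
    · obtain ⟨a, b, hab, hwa, hwb, haC, hbC⟩ := hG.2.1.exists_two_adj hwC
      by_cases ha : a ∈ S
      · exact ⟨a, ha, hwa.symm⟩
      by_cases hb : b ∈ S
      · exact ⟨b, hb, hwb.symm⟩
      exact (hG.not_isNonCut_triangle h4 hwa hwb (hclique a haC b hbC ha hb hab) (hcut w hw)
        (hcut a ha) (hcut b hb)).elim
    · obtain ⟨t, htw, -, -⟩ := exists_notMem_triple h4 w w w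
      obtain ⟨q⟩ := hG.1.preconnected w t
      cases q with
      | nil => exact absurd rfl htw
      | @cons _ u _ h q =>
        refine ⟨u, ?_, h.symm⟩
        by_contra hu
        exact hwC (hG.mem_cycle_of_isNonCut_of_adj (by omega) (hcut w hw) (hcut u hu) h)
  have hne : ∃ s, s ∈ S := by
    obtain ⟨v⟩ := hG.1.nonempty
    by_cases hv : v ∈ S
    · exact ⟨v, hv⟩
    · obtain ⟨u, hu, -⟩ := hdom v hv
      exact ⟨u, hu⟩
  refine ⟨hdom, ?_⟩
  obtain ⟨s, hs⟩ := hne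
  have : Nonempty (S : Set V) := ⟨⟨s, hs⟩⟩
  suffices h : (G.induce (S : Set V)).Preconnected from ⟨h⟩
  by_cases hx : ∃ x ∈ C.verts, x ∉ S
  · -- Delete first one missing cycle vertex `x`; the other missing vertices are leaves of `G - x`.
    obtain ⟨x, hxC, hx⟩ := hx
    refine preconnected_induce_of_leaves (hcut x hx).preconnected (R := S)
      (fun w hw => by simp; rintro rfl; exact hx hw) ?_
    intro w hwx hwS a hax b hbx hwa hwb
    by_contra hab
    have hwC := hG.mem_cycle_of_isNonCut (hcut w hwS) hab hwa hwb
    have hwx' := hclique w hwC x hxC hwS hx hwx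
    rcases hG.eq_or_eq_of_isNonCut (hcut w hwS) hab hwa hwb hwx' with h | h
    · exact hax h.symm
    · exact hbx h.symm
  · push Not at hx
    have hT : (G.induce (Set.univ : Set V)).Preconnected :=
      (induceUnivIso G).symm.preconnected_iff.1 hG.1.preconnected
    refine preconnected_induce_of_leaves hT (Set.subset_univ _) ?_
    intro w _ hwS a _ b _ hwa hwb
    by_contra hab
    exact hwS (hx w (hG.mem_cycle_of_isNonCut (hcut w hwS) hab hwa hwb))

end Dominating

/-! ### Full vertices and the coalition number -/

section Basic

variable {V : Type*} [Fintype V] [DecidableEq V] {G : SimpleGraph V} [DecidableRel G.Adj]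

lemma isFullVertex_iff {v : V} : IsFullVertex G v ↔ ∀ w, w ≠ v → G.Adj v w := by
  have hsub : G.neighborFinset v ⊆ Finset.univ.erase v := by
    intro w hw
    simpa using ((G.mem_neighborFinset v w).1 hw).ne'
  have hcard : (Finset.univ.erase v).card = Fintype.card V - 1 := by
    rw [Finset.card_erase_of_mem (Finset.mem_univ v), Finset.card_univ]
  rw [IsFullVertex, ← card_neighborFinset_eq_degree, ← hcard]
  constructor
  · intro h w hw
    rw [← mem_neighborFinset, Finset.eq_of_subset_of_card_le hsub h.ge]
    simpa using hw
  · intro h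
    congr 1
    refine hsub.antisymm fun w hw => ?_
    rw [mem_neighborFinset]
    exact h w (by simpa using hw)

omit [Fintype V] [DecidableRel G.Adj] in
lemma isConnectedDominatingSet_pair {u v : V} (huv : G.Adj u v)
    (h : ∀ w, w ≠ u → w ≠ v → G.Adj u w ∨ G.Adj v w) :
    IsConnectedDominatingSet G ({u} ∪ {v}) := by
  refine ⟨fun w hw => ?_, ?_⟩
  · simp only [Finset.mem_union, Finset.mem_singleton, not_or] at hw
    rcases h w hw.1 hw.2 with h | h
    · exact ⟨u, by simp, h⟩
    · exact ⟨v, by simp, h⟩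
  · rw [Finset.coe_union, Finset.coe_singleton, Finset.coe_singleton, ← Set.insert_eq]
    exact induce_pair_connected_of_adj huv

lemma isConnectedDominatingSet_singleton_iff {v : V} :
    IsConnectedDominatingSet G {v} ↔ IsFullVertex G v := by
  rw [isFullVertex_iff]
  constructor
  · rintro ⟨hdom, -⟩ w hw
    obtain ⟨u, hu, huw⟩ := hdom w (by simpa using hw)
    rwa [Finset.mem_singleton.1 hu] at huw
  · intro h
    refine ⟨fun w hw => ⟨v, by simp, h w (by simpa using hw)⟩, ?_⟩
    rw [Finset.coe_singleton]
    have : Nonempty ({v} : Set V) := ⟨⟨v, rfl⟩⟩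
    exact ⟨Preconnected.of_subsingleton⟩

lemma IsFullVertex.isConnectedDominatingSet {v : V} (hv : IsFullVertex G v) {S : Finset V}
    (h : v ∈ S) : IsConnectedDominatingSet G S :=
  (isConnectedDominatingSet_singleton_iff.2 hv).mono (by simpa using h)

lemma CC_eq_of_le {k : ℕ} (P : Finpartition (Finset.univ : Finset V))
    (hP : IsConnectedCoalitionPartition G P) (hk : P.parts.card = k)
    (hle : ∀ Q : Finpartition (Finset.univ : Finset V), IsConnectedCoalitionPartition G Q →
      Q.parts.card ≤ k) : CC G = k := by
  refine IsGreatest.csSup_eq ⟨⟨P, hP, hk⟩, ?_⟩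
  rintro _ ⟨Q, hQ, rfl⟩
  exact hle Q hQ

/-- If all vertices are full, or, more generally, all singletons satisfy the requirement on the
parts, then the coalition number is the order of the graph. -/
lemma CC_eq_card
    (h : ∀ v, IsFullVertex G v ∨ ∃ u, u ≠ v ∧ IsConnectedCoalition G {v} {u}) :
    CC G = Fintype.card V := by
  refine CC_eq_of_le ⊥ ?_ (by rw [Finpartition.card_bot, Finset.card_univ]) fun Q _ => ?_
  · intro A hA
    rw [Finpartition.parts_bot, Finset.mem_map] at hA
    obtain ⟨v, -, rfl⟩ := hA
    rcases h v with h | ⟨u, huv, hu⟩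
    · exact Or.inl ⟨v, h, rfl⟩
    · refine Or.inr ⟨{u}, ?_, by simpa using huv, hu⟩
      rw [Finpartition.parts_bot, Finset.mem_map]
      exact ⟨u, Finset.mem_univ u, rfl⟩
  · simpa using Q.card_parts_le_card

end Basic

/-! ### The exceptional graphs -/

section Exceptional

lemma triangleWithStar_adj {k : ℕ} {a b : Fin 3 ⊕ Fin k} : (triangleWithStar k).Adj a b ↔
    a ≠ b ∧ (a = Sum.inl 0 ∨ b = Sum.inl 0 ∨ (a.isLeft ∧ b.isLeft)) := by
  rcases a with a | a <;> rcases b with b | b <;>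
    simp [triangleWithStar, map_adj', Option.exists, eq_comm]

variable {V : Type*} [Fintype V] [DecidableEq V] {G : SimpleGraph V} [DecidableRel G.Adj]

lemma CC_eq_four_of_iso_cycleGraph (h : Nonempty (G ≃g cycleGraph 4)) : CC G = 4 := by
  obtain ⟨e⟩ := h
  have hcard : Fintype.card V = 4 := by
    rw [Fintype.card_congr e.toEquiv, Fintype.card_fin]
  have key : ∀ i : Fin 4, ∃ j, (cycleGraph 4).Adj i j ∧
      ∀ l, l ≠ i → l ≠ j → (cycleGraph 4).Adj i l ∨ (cycleGraph 4).Adj j l := by decide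
  have key' : ∀ i : Fin 4, ∃ j, j ≠ i ∧ ¬ (cycleGraph 4).Adj i j := by decide
  have hfull : ∀ v, ¬ IsFullVertex G v := by
    intro v hv
    obtain ⟨j, hj, hj'⟩ := key' (e v)
    refine hj' ?_
    have := isFullVertex_iff.1 hv (e.symm j) (by rw [ne_eq, e.symm_apply_eq]; exact hj)
    rwa [← e.map_adj_iff, e.apply_symm_apply] at this
  rw [← hcard]
  refine CC_eq_card fun v => Or.inr ?_
  obtain ⟨j, hj, hj'⟩ := key (e v)
  have hadj : G.Adj v (e.symm j) := by rwa [← e.map_adj_iff, e.apply_symm_apply]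
  refine ⟨e.symm j, hadj.ne', by simpa using hadj.ne,
    isConnectedDominatingSet_pair hadj fun w hw hw' => ?_,
    mt isConnectedDominatingSet_singleton_iff.1 (hfull _),
    mt isConnectedDominatingSet_singleton_iff.1 (hfull _)⟩
  have := hj' (e w) (by simpa using hw) (by rwa [ne_eq, ← e.eq_symm_apply])
  rw [← e.map_adj_iff, ← e.map_adj_iff, e.apply_symm_apply]
  exact this

/-- If a full vertex `v` has a pendant neighbour `w`, there is no connected coalition partition:
`{v}` must be a part and takes part in no coalition, and a connected set that contains `w` but not
`v` is `{w}`, which is not a union of two nonempty disjoint sets. -/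
lemma CC_eq_zero_of_leaf {v w : V} (hv : IsFullVertex G v) (hwv : w ≠ v)
    (hw : ∀ u, G.Adj w u → u = v) (h3 : 3 ≤ Fintype.card V) : CC G = 0 := by
  have hwfull : ¬ IsFullVertex G w := by
    intro h
    have : (Finset.univ : Finset V) ⊆ {w, v} := by
      intro u _
      by_cases huw : u = w
      · simp [huw]
      · simp [hw u (isFullVertex_iff.1 h u huw)]
    have := Finset.card_le_card this
    have h2 : ({w, v} : Finset V).card ≤ 2 := Finset.card_le_two
    rw [Finset.card_univ] at this
    omega
  have hempty : ∀ P : Finpartition (Finset.univ : Finset V),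
      ¬ IsConnectedCoalitionPartition G P := by
    intro P hP
    have hvpart : ∀ A ∈ P.parts, v ∈ A → A = {v} := by
      intro A hA hvA
      rcases hP A hA with ⟨u, -, rfl⟩ | ⟨B, -, -, hAB⟩
      · rw [Finset.mem_singleton.1 hvA]
      · exact absurd (hv.isConnectedDominatingSet hvA) hAB.2.2.1
    obtain ⟨A, hA, hwA⟩ := P.exists_mem (Finset.mem_univ w)
    rcases hP A hA with ⟨u, hu, rfl⟩ | ⟨B, hB, -, hAB⟩
    · rw [Finset.mem_singleton.1 hwA] at hwfull
      exact hwfull hu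
    · have hvA : v ∉ A := by
        intro h
        rw [hvpart A hA h, Finset.mem_singleton] at hwA
        exact hwv hwA
      have hvB : v ∉ B := fun h => hAB.2.2.2 (hv.isConnectedDominatingSet h)
      obtain ⟨b, hb⟩ := P.nonempty_of_mem_parts hB
      obtain ⟨q, -, hq⟩ := exists_isPath_of_preconnected_induce hAB.2.1.2.preconnected
        (a := w) (b := b) (by simp [hwA]) (by simp [hb])
      cases q with
      | nil => exact Finset.disjoint_left.1 hAB.1 hwA hb
      | cons h q =>
        have := hq _ (List.mem_cons_of_mem _ q.start_mem_support)
        rw [hw _ h] at this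
        simp [hvA, hvB] at this
  have : {k : ℕ | ∃ P : Finpartition (Finset.univ : Finset V),
      IsConnectedCoalitionPartition G P ∧ P.parts.card = k} = ∅ := by
    ext k
    simp only [Set.mem_ofPred_eq, Set.mem_empty_iff_false, iff_false]
    rintro ⟨P, hP, -⟩
    exact hempty P hP
  rw [CC, this, csSup_empty, bot_eq_zero]

lemma CC_eq_zero_of_isTriangleWithStar (h : IsTriangleWithStar G) : CC G = 0 := by
  obtain ⟨k, hk, ⟨e⟩⟩ := h
  have hcard : Fintype.card V = 3 + k := by
    rw [Fintype.card_congr e.toEquiv, Fintype.card_sum, Fintype.card_fin, Fintype.card_fin]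
  refine CC_eq_zero_of_leaf (v := e.symm (Sum.inl 0)) (w := e.symm (Sum.inr ⟨0, hk⟩)) ?_
    (by simp) ?_ (by omega)
  · rw [isFullVertex_iff]
    intro w hw
    rw [← e.map_adj_iff, e.apply_symm_apply, triangleWithStar_adj]
    refine ⟨fun h => hw ?_, Or.inl rfl⟩
    rw [h, e.symm_apply_apply]
  · intro u hu
    rw [← e.map_adj_iff, e.apply_symm_apply, triangleWithStar_adj] at hu
    rw [e.eq_symm_apply]
    simpa using hu.2

/-- A unicyclic graph of order at least four with a full vertex is a triangle with a star: any edge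
that avoids the full vertex spans a triangle with it, and there is only one triangle. -/
lemma IsUnicyclicWith.isTriangleWithStar_of_isFullVertex {C : G.Subgraph}
    (hG : IsUnicyclicWith G C) (h4 : 4 ≤ Fintype.card V) {v : V} (hv : IsFullVertex G v) :
    IsTriangleWithStar G := by
  rw [isFullVertex_iff] at hv
  -- As each cycle vertex has two neighbours on the cycle, some edge `xy` on it avoids `v`.
  obtain ⟨x, y, hxv, hyv, hxy, hxC, hyC⟩ :
      ∃ x y, x ≠ v ∧ y ≠ v ∧ G.Adj x y ∧ x ∈ C.verts ∧ y ∈ C.verts := by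
    have hstep : ∀ x ∈ C.verts, ∃ y ∈ C.verts, G.Adj x y ∧ y ≠ v := by
      intro x hx
      obtain ⟨a, b, hab, hxa, hxb, ha, hb⟩ := hG.2.1.exists_two_adj hx
      by_cases hav : a = v
      · exact ⟨b, hb, hxb, fun h => hab (hav.trans h.symm)⟩
      · exact ⟨a, ha, hxa, hav⟩
    obtain ⟨z, hz⟩ := hG.2.1.nonempty
    obtain ⟨x, hx, -, hxv⟩ := hstep z hz
    obtain ⟨y, hy, hxy, hyv⟩ := hstep x hx
    exact ⟨x, y, hxv, hyv, hxy, hx, hy⟩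
  have hedge : ∀ a b, a ≠ v → b ≠ v → G.Adj a b → (x = a ∨ x = b) ∧ (y = a ∨ y = b) := by
    intro a b ha hb hab
    have hsub := hG.cycle_subset_triangle (hv a ha) (hv b hb) hab
    have h1 := hsub hxC
    have h2 := hsub hyC
    simp only [Set.mem_insert_iff, Set.mem_singleton_iff] at h1 h2
    tauto
  have hadj : ∀ a b, G.Adj a b ↔ a ≠ b ∧ (a = v ∨ b = v ∨
      ((a = v ∨ a = x ∨ a = y) ∧ (b = v ∨ b = x ∨ b = y))) := by
    intro a b
    constructor
    · intro h
      refine ⟨h.ne, ?_⟩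
      by_cases ha : a = v
      · exact Or.inl ha
      by_cases hb : b = v
      · exact Or.inr (Or.inl hb)
      have := hedge a b ha hb h
      have := hxy.ne
      grind
    · rintro ⟨hab, rfl | rfl | h⟩
      · exact hv b hab.symm
      · exact (hv a hab).symm
      · have := hxy.symm
        rcases h with ⟨rfl | rfl | rfl, rfl | rfl | rfl⟩ <;>
          first | exact absurd rfl hab | assumption | exact hv _ (by assumption) |
            exact (hv _ (by assumption)).symm
  let e := (Fintype.equivFin {w // w ≠ v ∧ w ≠ x ∧ w ≠ y}).symm
  let f : Fin 3 ⊕ Fin (Fintype.card {w // w ≠ v ∧ w ≠ x ∧ w ≠ y}) → V :=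
    Sum.elim ![v, x, y] fun i => (e i).1
  have hf : Function.Bijective f := by
    constructor
    · have := hxy.ne
      refine Function.Injective.sumElim ?_ (Subtype.val_injective.comp e.injective) ?_
      · intro i j hij
        fin_cases i <;> fin_cases j <;> simp_all
      · intro i j
        have := (e j).2
        fin_cases i
        · exact this.1.symm
        · exact this.2.1.symm
        · exact this.2.2.symm
    · intro w
      by_cases hw : w ≠ v ∧ w ≠ x ∧ w ≠ y
      · exact ⟨Sum.inr (e.symm ⟨w, hw⟩), by simp [f]⟩
      · by_cases h1 : w = v
        · exact ⟨Sum.inl 0, h1.symm⟩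
        by_cases h2 : w = x
        · exact ⟨Sum.inl 1, h2.symm⟩
        by_cases h3 : w = y
        · exact ⟨Sum.inl 2, h3.symm⟩
        exact absurd ⟨h1, h2, h3⟩ hw
  have hf0 : ∀ a, f a = v ↔ a = Sum.inl 0 := fun a => hf.1.eq_iff' (b := Sum.inl 0) rfl
  have hfl : ∀ a, (f a = v ∨ f a = x ∨ f a = y) ↔ a.isLeft := by
    rintro (i | i)
    · fin_cases i <;> simp [f]
    · have := (e i).2
      simpa [f] using this
  obtain ⟨d, hd⟩ := exists_notMem_triple h4 v x y
  refine ⟨_, Fintype.card_pos_iff.2 ⟨⟨d, hd⟩⟩, ⟨(Iso.symm ⟨Equiv.ofBijective f hf, ?_⟩)⟩⟩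
  intro a b
  rw [triangleWithStar_adj, Equiv.ofBijective_apply, Equiv.ofBijective_apply, hadj, hfl, hfl, hf0,
    hf0, hf.1.ne_iff]

lemma IsUnicyclicWith.CC_eq_three_of_card_le_three {C : G.Subgraph} (hG : IsUnicyclicWith G C)
    (h3 : Fintype.card V ≤ 3) : CC G = 3 := by
  obtain ⟨x, hx⟩ := hG.2.1.nonempty
  obtain ⟨a, b, hab, hxa, hxb, haC, hbC⟩ := hG.2.1.exists_two_adj hx
  have htriple : ∀ x a b : V, G.Adj x a → G.Adj x b → a ≠ b →
      Fintype.card V = 3 ∧ ∀ w, w = x ∨ w = a ∨ w = b := by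
    intro x a b hxa hxb hab
    have hcard : ({x, a, b} : Finset V).card = 3 :=
      Finset.card_eq_three.2 ⟨x, a, b, hxa.ne, hxb.ne, hab, rfl⟩
    have huniv : ({x, a, b} : Finset V) = Finset.univ :=
      Finset.eq_univ_of_card _ (le_antisymm (Finset.card_le_univ _) (by omega))
    refine ⟨by rw [← Finset.card_univ, ← huniv, hcard], fun w => ?_⟩
    have := Finset.mem_univ w
    rw [← huniv] at this
    simpa using this
  obtain ⟨hcard, hV⟩ := htriple x a b hxa hxb hab
  rw [← hcard]
  refine CC_eq_card fun v => Or.inl ?_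
  have hvC : v ∈ C.verts := by
    rcases hV v with rfl | rfl | rfl <;> assumption
  obtain ⟨c, d, hcd, hvc, hvd, -, -⟩ := hG.2.1.exists_two_adj hvC
  rw [isFullVertex_iff]
  intro w hw
  rcases (htriple v c d hvc hvd hcd).2 w with rfl | rfl | rfl
  · exact absurd rfl hw
  · exact hvc
  · exact hvd

/-- In order four, having no full vertex bounds all degrees by two. So a cycle vertex `x` with
neighbours `a`, `b` is not adjacent to the fourth vertex `d`; connectedness excludes the edge `ab`,
and `a` and `b`, being on the cycle, are both adjacent to `d`. -/
lemma IsUnicyclicWith.iso_cycleGraph_four {C : G.Subgraph} (hG : IsUnicyclicWith G C)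
    (h4 : Fintype.card V = 4) (hfull : ∀ v, ¬ IsFullVertex G v) :
    Nonempty (G ≃g cycleGraph 4) := by
  simp only [isFullVertex_iff] at hfull
  obtain ⟨x, hx⟩ := hG.2.1.nonempty
  obtain ⟨a, b, hab, hxa, hxb, haC, hbC⟩ := hG.2.1.exists_two_adj hx
  obtain ⟨d, hdx, hda, hdb⟩ := exists_notMem_triple h4.ge x a b
  have hinj : Function.Injective ![x, a, d, b] := by
    have := hxa.ne
    have := hxb.ne
    intro i j hij
    fin_cases i <;> fin_cases j <;> simp_all
  have hbij : Function.Bijective ![x, a, d, b] :=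
    (Fintype.bijective_iff_injective_and_card _).2 ⟨hinj, by simp [h4]⟩
  have hV : ∀ w, w = x ∨ w = a ∨ w = d ∨ w = b := by
    intro w
    obtain ⟨i, rfl⟩ := hbij.2 w
    fin_cases i <;> simp
  have hxd : ¬ G.Adj x d := by
    intro h
    refine hfull x fun w hw => ?_
    rcases hV w with rfl | rfl | rfl | rfl <;> first | assumption | exact absurd rfl hw
  have hnab : ¬ G.Adj a b := by
    intro h
    have had : ¬ G.Adj a d := by
      intro h'
      refine hfull a fun w hw => ?_
      rcases hV w with rfl | rfl | rfl | rfl <;>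
        first | assumption | exact absurd rfl hw | exact hxa.symm
    have hbd : ¬ G.Adj b d := by
      intro h'
      refine hfull b fun w hw => ?_
      rcases hV w with rfl | rfl | rfl | rfl <;>
        first | assumption | exact absurd rfl hw | exact hxb.symm | exact h.symm
    have : d ∈ ({x, a, b} : Set V) := by
      refine eq_univ_of_closed hG.1 ⟨x, by simp⟩ ?_ d
      intro z hz y hy
      rcases hV y with rfl | rfl | rfl | rfl
      · simp
      · simp
      · rcases hz with rfl | rfl | rfl <;> contradiction
      · simp
    simp [hdx, hda, hdb] at this
  have hsecond : ∀ u ∈ C.verts, ∀ t, (∀ w, G.Adj u w → w = t ∨ w = d) → G.Adj u d := by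
    intro u hu t ht
    obtain ⟨p, q, hpq, hup, huq, -, -⟩ := hG.2.1.exists_two_adj hu
    rcases ht p hup with rfl | rfl
    · rcases ht q huq with rfl | rfl
      · exact absurd rfl hpq
      · exact huq
    · exact hup
  have had : G.Adj a d := by
    refine hsecond a haC x fun w hw => ?_
    rcases hV w with rfl | rfl | rfl | rfl
    · exact Or.inl rfl
    · exact absurd rfl hw.ne
    · exact Or.inr rfl
    · exact absurd hw hnab
  have hbd : G.Adj b d := by
    refine hsecond b hbC x fun w hw => ?_
    rcases hV w with rfl | rfl | rfl | rfl
    · exact Or.inl rfl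
    · exact absurd hw.symm hnab
    · exact Or.inr rfl
    · exact absurd rfl hw.ne
  have hcyc : ∀ i j : Fin 4, (cycleGraph 4).Adj i j ↔ i ≠ j ∧ j ≠ i + 2 := by decide
  refine ⟨(Iso.symm ⟨Equiv.ofBijective _ hbij, ?_⟩)⟩
  intro i j
  rw [hcyc, Equiv.ofBijective_apply, Equiv.ofBijective_apply]
  fin_cases i <;> fin_cases j <;>
    simp [hxa, hxa.symm, hxb, hxb.symm, had, had.symm, hbd, hbd.symm, hnab,
      mt (fun h : G.Adj b a => h.symm) hnab, hxd, mt (fun h : G.Adj d x => h.symm) hxd]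

end Exceptional

/-! ### Upper bounds -/

section Bounds

variable {V : Type*} [Fintype V] [DecidableEq V] {G : SimpleGraph V} [DecidableRel G.Adj]
  {C : G.Subgraph} {P : Finpartition (Finset.univ : Finset V)}

lemma IsConnectedCoalitionPartition.exists_coalition (hP : IsConnectedCoalitionPartition G P)
    (hfull : ∀ v, ¬ IsFullVertex G v) {A : Finset V} (hA : A ∈ P.parts) :
    ∃ B ∈ P.parts, B ≠ A ∧ IsConnectedCoalition G A B := by
  rcases hP A hA with ⟨v, hv, -⟩ | h
  · exact absurd hv (hfull v)
  · exact h

/-- If there is a cut vertex and there are at least three parts, then the part `A` that contains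
the cut vertex takes part in all coalitions, hence misses no other cut vertex. As `A` is not a
connected dominating set, it misses two nonadjacent cycle vertices, and each of the other parts
has to contain one of them. -/
lemma IsUnicyclicWith.card_parts_le_three_of_cut (hG : IsUnicyclicWith G C)
    (h4 : 4 ≤ Fintype.card V) (hfull : ∀ v, ¬ IsFullVertex G v)
    (hP : IsConnectedCoalitionPartition G P) {c : V} (hc : ¬ IsNonCut G c)
    (h3 : 3 ≤ P.parts.card) :
    P.parts.card ≤ 3 ∧ ∃ y ∈ nonCutCycleVertices G C, ∃ z ∈ nonCutCycleVertices G C,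
      y ≠ z ∧ ¬ G.Adj y z := by
  obtain ⟨A, hA, hcA⟩ := P.exists_mem (Finset.mem_univ c)
  have hpartner : ∀ B ∈ P.parts, B ≠ A → IsConnectedCoalition G B A := by
    intro B hB hBA
    obtain ⟨D, hD, -, hBD⟩ := hP.exists_coalition hfull hB
    have hcBD : c ∈ B ∪ D := by
      by_contra h
      exact hc (hBD.2.1.isNonCut h)
    rcases Finset.mem_union.1 hcBD with h | h
    · exact absurd (P.eq_of_mem_parts hB hA h hcA) hBA
    · rwa [P.eq_of_mem_parts hD hA h hcA] at hBD
  have hcut : ∀ v, v ∉ A → IsNonCut G v := by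
    intro v hv
    obtain ⟨B, hB, hvB⟩ := P.exists_mem (Finset.mem_univ v)
    obtain ⟨D, hD, hDAB⟩ := Finset.exists_mem_notMem_of_card_lt_card
      (show ({A, B} : Finset (Finset V)).card < P.parts.card from
        lt_of_le_of_lt Finset.card_le_two h3)
    simp only [Finset.mem_insert, Finset.mem_singleton, not_or] at hDAB
    refine (hpartner D hD hDAB.1).2.1.isNonCut (v := v) ?_
    rw [Finset.mem_union, not_or]
    exact ⟨fun h => hDAB.2 (P.eq_of_mem_parts hD hB h hvB), hv⟩
  obtain ⟨y, z, hyC, hzC, hyA, hzA, hyz, hadj⟩ : ∃ y z, y ∈ C.verts ∧ z ∈ C.verts ∧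
      y ∉ A ∧ z ∉ A ∧ y ≠ z ∧ ¬ G.Adj y z := by
    by_contra! h
    obtain ⟨B, -, -, hAB⟩ := hP.exists_coalition hfull hA
    exact hAB.2.2.1 (hG.isConnectedDominatingSet h4 hcut
      fun x hx w hw hxA hwA hxw => h x w hx hw hxA hwA hxw)
  refine ⟨?_, y, ⟨hyC, hcut y hyA⟩, z, ⟨hzC, hcut z hzA⟩, hyz, hadj⟩
  obtain ⟨Y, hY, hyY⟩ := P.exists_mem (Finset.mem_univ y)
  obtain ⟨Z, hZ, hzZ⟩ := P.exists_mem (Finset.mem_univ z)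
  have hsub : P.parts ⊆ {A, Y, Z} := by
    intro B hB
    by_contra hB'
    simp only [Finset.mem_insert, Finset.mem_singleton, not_or] at hB'
    refine hadj (hG.adj_of_notMem (hpartner B hB hB'.1).2.1 ?_ ?_ hyC hzC hyz)
    · rw [Finset.mem_union, not_or]
      exact ⟨fun h => hB'.2.1 (P.eq_of_mem_parts hB hY h hyY), hyA⟩
    · rw [Finset.mem_union, not_or]
      exact ⟨fun h => hB'.2.2 (P.eq_of_mem_parts hB hZ h hzZ), hzA⟩
  exact (Finset.card_le_card hsub).trans Finset.card_le_three

/-- Without cut vertices (that is, for a cycle), a connected dominating set misses at most two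
vertices. With four parts, each coalition thus leaves out exactly two parts, both of them
singletons; so all coalitions share the one large part `A`, and representatives of the other three
parts are pairwise adjacent. -/
lemma IsUnicyclicWith.card_parts_le_three_of_forall_isNonCut (hG : IsUnicyclicWith G C)
    (h5 : 5 ≤ Fintype.card V) (hfull : ∀ v, ¬ IsFullVertex G v)
    (hP : IsConnectedCoalitionPartition G P) (hcut : ∀ v, IsNonCut G v) :
    P.parts.card ≤ 3 := by
  by_contra! hcard
  have hC : ∀ v, v ∈ C.verts := by
    intro v
    obtain ⟨t, htv, -, -⟩ := exists_notMem_triple (by omega) v v v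
    obtain ⟨q⟩ := hG.1.preconnected v t
    cases q with
    | nil => exact absurd rfl htv
    | cons h q => exact hG.mem_cycle_of_isNonCut_of_adj (by omega) (hcut _) (hcut _) h
  have hout : ∀ {A B : Finset V}, IsConnectedCoalition G A B → ∀ {x y z : V},
      x ∉ A ∪ B → y ∉ A ∪ B → z ∉ A ∪ B → x ≠ y → x ≠ z → y ≠ z → False := by
    intro A B hAB x y z hx hy hz hxy hxz hyz
    exact hG.not_isNonCut_triangle (by omega)
      (hG.adj_of_notMem hAB.2.1 hx hy (hC x) (hC y) hxy)
      (hG.adj_of_notMem hAB.2.1 hx hz (hC x) (hC z) hxz)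
      (hG.adj_of_notMem hAB.2.1 hy hz (hC y) (hC z) hyz) (hcut x) (hcut y) (hcut z)
  have hmem : ∀ {A B D : Finset V} {x : V}, A ∈ P.parts → B ∈ P.parts → D ∈ P.parts → D ≠ A →
      D ≠ B → x ∈ D → x ∉ A ∪ B := by
    intro A B D x hA hB hD hDA hDB hx
    rw [Finset.mem_union, not_or]
    exact ⟨fun h => hDA (P.eq_of_mem_parts hD hA hx h),
      fun h => hDB (P.eq_of_mem_parts hD hB hx h)⟩
  have hne : ∀ {D E : Finset V} {x y : V}, D ∈ P.parts → E ∈ P.parts → D ≠ E → x ∈ D → y ∈ E →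
      x ≠ y := by
    rintro D E x y hD hE hDE hx hy rfl
    exact hDE (P.eq_of_mem_parts hD hE hx hy)
  have hsmall : ∀ {A B D : Finset V}, A ∈ P.parts → B ∈ P.parts → IsConnectedCoalition G A B →
      D ∈ P.parts → D ≠ A → D ≠ B → D.card ≤ 1 := by
    intro A B D hA hB hAB hD hDA hDB
    by_contra! h
    obtain ⟨x, hx, y, hy, hxy⟩ := Finset.one_lt_card.1 h
    obtain ⟨E, hE, hE'⟩ := Finset.exists_mem_notMem_of_card_lt_card
      (show ({A, B, D} : Finset (Finset V)).card < P.parts.card from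
        lt_of_le_of_lt Finset.card_le_three hcard)
    simp only [Finset.mem_insert, Finset.mem_singleton, not_or] at hE'
    obtain ⟨z, hz⟩ := P.nonempty_of_mem_parts hE
    exact hout hAB (hmem hA hB hD hDA hDB hx) (hmem hA hB hD hDA hDB hy)
      (hmem hA hB hE hE'.1 hE'.2.1 hz) hxy (hne hD hE (Ne.symm hE'.2.2) hx hz)
      (hne hD hE (Ne.symm hE'.2.2) hy hz)
  have hlarge : ∀ {A B : Finset V}, IsConnectedCoalition G A B → 3 ≤ A.card + B.card := by
    intro A B hAB
    have h2 : (A ∪ B)ᶜ.card ≤ 2 := by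
      by_contra! h
      obtain ⟨x, hx, y, hy, z, hz, hxy, hxz, hyz⟩ := Finset.two_lt_card.1 h
      rw [Finset.mem_compl] at hx hy hz
      exact hout hAB hx hy hz hxy hxz hyz
    rw [Finset.card_compl] at h2
    have := Finset.card_union_le A B
    omega
  -- The partner of a part `D` outside the coalition `A`, `B` is `A` or `B`, whichever is large.
  have hpartner : ∀ {A B D : Finset V}, A ∈ P.parts → B ∈ P.parts → IsConnectedCoalition G A B →
      D ∈ P.parts → D ≠ A → D ≠ B → ∃ F, (F = A ∨ F = B) ∧ 2 ≤ F.card ∧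
        IsConnectedCoalition G D F := by
    intro A B D hA hB hAB hD hDA hDB
    obtain ⟨F, hF, -, hDF⟩ := hP.exists_coalition hfull hD
    have h1 := hsmall hA hB hAB hD hDA hDB
    have h2 := hlarge hDF
    refine ⟨F, ?_, by omega, hDF⟩
    by_contra! h
    have := hsmall hA hB hAB hF h.1 h.2
    omega
  -- If `A` has partners `B` and `D`, then `B` is small too, so `A` is also the partner of `E`.
  have hmain : ∀ {A B D E : Finset V}, A ∈ P.parts → B ∈ P.parts → D ∈ P.parts → E ∈ P.parts →
      B ≠ A → D ≠ A → E ≠ A → D ≠ B → E ≠ B → D ≠ E → IsConnectedCoalition G A B →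
      IsConnectedCoalition G D A → False := by
    intro A B D E hA hB hD hE hBA hDA hEA hDB hEB hDE hAB hAD
    have hB1 := hsmall hD hA hAD hB hDB.symm hBA
    obtain ⟨F, hF, hF2, hEF⟩ := hpartner hA hB hAB hE hEA hEB
    obtain rfl : F = A := by
      rcases hF with h | rfl
      · exact h
      · omega
    obtain ⟨x, hx⟩ := P.nonempty_of_mem_parts hB
    obtain ⟨y, hy⟩ := P.nonempty_of_mem_parts hD
    obtain ⟨z, hz⟩ := P.nonempty_of_mem_parts hE
    exact hG.not_isNonCut_triangle (by omega)
      (hG.adj_of_notMem hEF.2.1 (hmem hE hA hB hEB.symm hBA hx) (hmem hE hA hD hDE hDA hy)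
        (hC x) (hC y) (hne hB hD hDB.symm hx hy))
      (hG.adj_of_notMem hAD.2.1 (hmem hD hA hB hDB.symm hBA hx) (hmem hD hA hE hDE.symm hEA hz)
        (hC x) (hC z) (hne hB hE hEB.symm hx hz))
      (hG.adj_of_notMem hAB.2.1 (hmem hA hB hD hDA hDB hy) (hmem hA hB hE hEA hEB hz)
        (hC y) (hC z) (hne hD hE hDE hy hz)) (hcut x) (hcut y) (hcut z)
  obtain ⟨A, hA⟩ : P.parts.Nonempty := Finset.card_pos.1 (by omega)
  obtain ⟨B, hB, hBA, hAB⟩ := hP.exists_coalition hfull hA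
  obtain ⟨D, hD, hD'⟩ := Finset.exists_mem_notMem_of_card_lt_card
    (show ({A, B} : Finset (Finset V)).card < P.parts.card from
      lt_of_le_of_lt Finset.card_le_two (by omega))
  obtain ⟨E, hE, hE'⟩ := Finset.exists_mem_notMem_of_card_lt_card
    (show ({A, B, D} : Finset (Finset V)).card < P.parts.card from
      lt_of_le_of_lt Finset.card_le_three hcard)
  simp only [Finset.mem_insert, Finset.mem_singleton, not_or] at hD' hE'
  obtain ⟨F, rfl | rfl, -, hDF⟩ := hpartner hA hB hAB hD hD'.1 hD'.2
  · exact hmain hA hB hD hE hBA hD'.1 hE'.1 hD'.2 hE'.2.1 (Ne.symm hE'.2.2) hAB hDF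
  · have hBA' : IsConnectedCoalition G F A :=
      ⟨hAB.1.symm, by rw [Finset.union_comm]; exact hAB.2.1, hAB.2.2.2, hAB.2.2.1⟩
    exact hmain hB hA hD hE hBA.symm hD'.2 hE'.2.1 hD'.1 hE'.1 (Ne.symm hE'.2.2) hBA' hDF

lemma IsUnicyclicWith.card_parts_le_three (hG : IsUnicyclicWith G C)
    (h5 : 5 ≤ Fintype.card V) (hfull : ∀ v, ¬ IsFullVertex G v)
    (hP : IsConnectedCoalitionPartition G P) : P.parts.card ≤ 3 := by
  by_cases h3 : 3 ≤ P.parts.card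
  · by_cases hcut : ∀ v, IsNonCut G v
    · exact hG.card_parts_le_three_of_forall_isNonCut h5 hfull hP hcut
    · push Not at hcut
      obtain ⟨c, hc⟩ := hcut
      exact (hG.card_parts_le_three_of_cut (by omega) hfull hP hc h3).1
  · omega

/-! ### The condition on the non-cut cycle vertices -/

omit [DecidableEq V] [DecidableRel G.Adj] in
lemma IsUnicyclicWith.atMostOneOrEdge_iff (hG : IsUnicyclicWith G C) (h4 : 4 ≤ Fintype.card V) :
    AtMostOneOrEdge G (nonCutCycleVertices G C) ↔
      ∀ y ∈ nonCutCycleVertices G C, ∀ z ∈ nonCutCycleVertices G C, y ≠ z → G.Adj y z := by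
  constructor
  · rintro (h | ⟨⟨e⟩⟩) y hy z hz hyz
    · exact absurd ((Set.ncard_le_one (Set.toFinite _)).1 h y hy z hz) hyz
    · have : (G.induce (nonCutCycleVertices G C)).Adj ⟨y, hy⟩ ⟨z, hz⟩ := by
        rw [← e.map_adj_iff, top_adj, ne_eq, e.injective.eq_iff]
        simpa using hyz
      exact this
  · intro h
    by_cases h1 : (nonCutCycleVertices G C).ncard ≤ 1
    · exact Or.inl h1
    right
    have h2 : (nonCutCycleVertices G C).ncard ≤ 2 := by
      by_contra! h3
      obtain ⟨x, y, z, hx, hy, hz, hxy, hxz, hyz⟩ := (Set.two_lt_ncard_iff (Set.toFinite _)).1 h3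
      exact hG.not_isNonCut_triangle h4 (h x hx y hy hxy) (h x hx z hz hxz) (h y hy z hz hyz)
        hx.2 hy.2 hz.2
    have hcard : Nat.card (nonCutCycleVertices G C) = 2 := by
      rw [Nat.card_coe_set_eq]
      omega
    refine ⟨⟨Finite.equivFinOfCardEq hcard, ?_⟩⟩
    rintro ⟨y, hy⟩ ⟨z, hz⟩
    rw [top_adj, ne_eq, Equiv.apply_eq_iff_eq, comap_adj]
    exact ⟨fun hyz => h y hy z hz (by simpa using hyz), fun hyz => by simpa using hyz.ne⟩

/-! ### Optimal partitions -/

/-- Two nonadjacent non-cut vertices `y`, `z` of the cycle form three parts together with the set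
of all other vertices. -/
lemma IsUnicyclicWith.CC_eq_three (hG : IsUnicyclicWith G C) (h5 : 5 ≤ Fintype.card V)
    (hfull : ∀ v, ¬ IsFullVertex G v) {y z : V} (hy : y ∈ nonCutCycleVertices G C)
    (hz : z ∈ nonCutCycleVertices G C) (hyz : y ≠ z) (hadj : ¬ G.Adj y z) : CC G = 3 := by
  let R : Finset V := {y, z}ᶜ
  have hyR : y ∉ R := by simp [R]
  have hzR : z ∉ R := by simp [R]
  have hmemR : ∀ w, w ∈ R ↔ w ≠ y ∧ w ≠ z := by simp [R]
  have hRne : R.Nonempty := by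
    obtain ⟨d, hd, hd', -⟩ := exists_notMem_triple (by omega) y z z
    exact ⟨d, (hmemR d).2 ⟨hd, hd'⟩⟩
  have hRy : R ≠ {y} := by rintro h; exact hyR (by simp [h])
  have hRz : R ≠ {z} := by rintro h; exact hzR (by simp [h])
  have hRcds : ¬ IsConnectedDominatingSet G R := fun h =>
    hadj (hG.adj_of_notMem h hyR hzR hy.1 hz.1 hyz)
  have hunion : ∀ u t : V, IsNonCut G t → (∀ w, w ∉ ({u} ∪ R : Finset V) → w = t) →
      IsConnectedDominatingSet G ({u} ∪ R) := by
    intro u t ht hw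
    refine hG.isConnectedDominatingSet (by omega) (fun w h => hw w h ▸ ht) ?_
    intro a _ b _ ha hb hab
    exact absurd ((hw a ha).trans (hw b hb).symm) hab
  have hcoal : ∀ u t : V, IsNonCut G t → u ∉ R → (∀ w, w ∉ ({u} ∪ R : Finset V) → w = t) →
      IsConnectedCoalition G {u} R := fun u t ht huR hw =>
    ⟨by simpa using huR, hunion u t ht hw, mt isConnectedDominatingSet_singleton_iff.1 (hfull u),
      hRcds⟩
  have hcy : IsConnectedCoalition G {y} R := by
    refine hcoal y z hz.2 hyR fun w hw => ?_
    simp only [Finset.mem_union, Finset.mem_singleton, hmemR] at hw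
    tauto
  have hcz : IsConnectedCoalition G {z} R := by
    refine hcoal z y hy.2 hzR fun w hw => ?_
    simp only [Finset.mem_union, Finset.mem_singleton, hmemR] at hw
    tauto
  have hcy' : IsConnectedCoalition G R {y} :=
    ⟨hcy.1.symm, by rw [Finset.union_comm]; exact hcy.2.1, hcy.2.2.2, hcy.2.2.1⟩
  let P : Finpartition (Finset.univ : Finset V) :=
    Finpartition.ofExistsUnique {{y}, {z}, R} (fun p _ => Finset.subset_univ p)
      (by
        intro a _
        by_cases hay : a = y
        · subst hay
          exact ⟨{a}, by simp, by
            rintro t ⟨ht, hat⟩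
            simp only [Finset.mem_insert, Finset.mem_singleton] at ht
            rcases ht with rfl | rfl | rfl
            · rfl
            · exact absurd (Finset.mem_singleton.1 hat) hyz
            · exact absurd hat hyR⟩
        by_cases haz : a = z
        · subst haz
          exact ⟨{a}, by simp, by
            rintro t ⟨ht, hat⟩
            simp only [Finset.mem_insert, Finset.mem_singleton] at ht
            rcases ht with rfl | rfl | rfl
            · exact absurd (Finset.mem_singleton.1 hat) hay
            · rfl
            · exact absurd hat hzR⟩
        exact ⟨R, ⟨by simp, (hmemR a).2 ⟨hay, haz⟩⟩, by
          rintro t ⟨ht, hat⟩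
          simp only [Finset.mem_insert, Finset.mem_singleton] at ht
          rcases ht with rfl | rfl | rfl
          · exact absurd (Finset.mem_singleton.1 hat) hay
          · exact absurd (Finset.mem_singleton.1 hat) haz
          · rfl⟩)
      (by
        simp only [Finset.mem_insert, Finset.mem_singleton, not_or]
        exact ⟨(Finset.singleton_ne_empty y).symm, (Finset.singleton_ne_empty z).symm,
          hRne.ne_empty.symm⟩)
  have hparts : P.parts = {{y}, {z}, R} := rfl
  refine CC_eq_of_le P ?_ ?_ fun Q hQ => hG.card_parts_le_three h5 hfull hQ
  · intro A hA
    right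
    rw [hparts] at hA ⊢
    simp only [Finset.mem_insert, Finset.mem_singleton] at hA
    rcases hA with rfl | rfl | rfl
    · exact ⟨R, by simp, hRy, hcy⟩
    · exact ⟨R, by simp, hRz, hcz⟩
    · exact ⟨{y}, by simp, hRy.symm, hcy'⟩
  · rw [hparts]
    exact Finset.card_eq_three.2 ⟨_, _, _, by simpa using hyz, hRy.symm, hRz.symm, rfl⟩

/-- If the non-cut vertices of the cycle are pairwise adjacent, then there is a cut vertex `c`,
and the best partition is into `{c}` and its complement. -/
lemma IsUnicyclicWith.CC_eq_two (hG : IsUnicyclicWith G C) (h5 : 5 ≤ Fintype.card V)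
    (hfull : ∀ v, ¬ IsFullVertex G v)
    (hY : ∀ y ∈ nonCutCycleVertices G C, ∀ z ∈ nonCutCycleVertices G C, y ≠ z → G.Adj y z) :
    CC G = 2 := by
  obtain ⟨c, hc⟩ : ∃ c, ¬ IsNonCut G c := by
    by_contra! h
    obtain ⟨x, hx⟩ := hG.2.1.nonempty
    obtain ⟨a, b, hab, hxa, hxb, ha, hb⟩ := hG.2.1.exists_two_adj hx
    exact hG.not_isNonCut_triangle (by omega) hxa hxb (hY a ⟨ha, h a⟩ b ⟨hb, h b⟩ hab)
      (h x) (h a) (h b)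
  have hcc : c ∉ ({c}ᶜ : Finset V) := by simp
  have hne : ({c} : Finset V) ≠ {c}ᶜ := fun h => hcc (h ▸ Finset.mem_singleton_self c)
  have hcds : IsConnectedDominatingSet G Finset.univ :=
    hG.isConnectedDominatingSet (by omega) (fun v hv => absurd (Finset.mem_univ v) hv)
      fun x _ _ _ hx => absurd (Finset.mem_univ x) hx
  have hcoal : IsConnectedCoalition G {c} {c}ᶜ :=
    ⟨disjoint_compl_right, by rwa [Finset.union_compl],
      mt isConnectedDominatingSet_singleton_iff.1 (hfull c), fun h => hc (h.isNonCut hcc)⟩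
  have hcoal' : IsConnectedCoalition G {c}ᶜ {c} :=
    ⟨hcoal.1.symm, by rw [Finset.union_comm]; exact hcoal.2.1, hcoal.2.2.2, hcoal.2.2.1⟩
  let P : Finpartition (Finset.univ : Finset V) :=
    Finpartition.ofExistsUnique {{c}, {c}ᶜ} (fun p _ => Finset.subset_univ p)
      (by
        intro a _
        by_cases hac : a = c
        · exact ⟨{c}, by simp [hac], by
            rintro t ⟨ht, hat⟩
            simp only [Finset.mem_insert, Finset.mem_singleton] at ht
            rcases ht with rfl | rfl
            · rfl
            · simp [hac] at hat⟩
        · exact ⟨{c}ᶜ, by simp [hac], by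
            rintro t ⟨ht, hat⟩
            simp only [Finset.mem_insert, Finset.mem_singleton] at ht
            rcases ht with rfl | rfl
            · simp [hac] at hat
            · rfl⟩)
      (by
        simp only [Finset.mem_insert, Finset.mem_singleton, not_or]
        obtain ⟨d, hd, -, -⟩ := exists_notMem_triple (by omega) c c c
        refine ⟨(Finset.singleton_ne_empty c).symm, fun h => ?_⟩
        have : d ∈ ({c}ᶜ : Finset V) := by simpa using hd
        simp [← h] at this)
  have hparts : P.parts = {{c}, {c}ᶜ} := rfl
  refine CC_eq_of_le P ?_ ?_ fun Q hQ => ?_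
  · intro A hA
    right
    rw [hparts] at hA ⊢
    simp only [Finset.mem_insert, Finset.mem_singleton] at hA
    rcases hA with rfl | rfl
    · exact ⟨{c}ᶜ, by simp, hne.symm, hcoal⟩
    · exact ⟨{c}, by simp, hne, hcoal'⟩
  · rw [hparts, Finset.card_pair hne]
  · by_contra! h3
    obtain ⟨y, hy, z, hz, hyz, hadj⟩ :=
      (hG.card_parts_le_three_of_cut (by omega) hfull hQ hc h3).2
    exact hadj (hY y hy z hz hyz)

end Bounds

end ConnectedCoalition

theorem mainTheorem2 {V : Type*} [Fintype V] [DecidableEq V] (G : SimpleGraph V)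
    [DecidableRel G.Adj] (C : G.Subgraph) (hG : ConnectedCoalition.IsUnicyclicWith G C) :
    (Nonempty (G ≃g SimpleGraph.cycleGraph 4) → ConnectedCoalition.CC G = 4) ∧
    (ConnectedCoalition.IsTriangleWithStar G → ConnectedCoalition.CC G = 0) ∧
    (¬ Nonempty (G ≃g SimpleGraph.cycleGraph 4) → ¬ ConnectedCoalition.IsTriangleWithStar G →
      (5 ≤ Fintype.card V ∧ ConnectedCoalition.AtMostOneOrEdge G
        (ConnectedCoalition.nonCutCycleVertices G C) → ConnectedCoalition.CC G = 2) ∧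
      (¬ (5 ≤ Fintype.card V ∧ ConnectedCoalition.AtMostOneOrEdge G
        (ConnectedCoalition.nonCutCycleVertices G C)) → ConnectedCoalition.CC G = 3)) := by
  refine ⟨ConnectedCoalition.CC_eq_four_of_iso_cycleGraph,
    ConnectedCoalition.CC_eq_zero_of_isTriangleWithStar, fun hC4 hstar => ?_⟩
  have hfull : 4 ≤ Fintype.card V → ∀ v, ¬ ConnectedCoalition.IsFullVertex G v :=
    fun h4 v hv => hstar (hG.isTriangleWithStar_of_isFullVertex h4 hv)
  refine ⟨fun ⟨h5, hY⟩ => ?_, fun h => ?_⟩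
  · exact hG.CC_eq_two h5 (hfull (by omega)) ((hG.atMostOneOrEdge_iff (by omega)).1 hY)
  · by_cases h5 : 5 ≤ Fintype.card V
    · obtain ⟨y, hy, z, hz, hyz, hadj⟩ : ∃ y ∈ ConnectedCoalition.nonCutCycleVertices G C,
          ∃ z ∈ ConnectedCoalition.nonCutCycleVertices G C, y ≠ z ∧ ¬ G.Adj y z := by
        by_contra! hclique
        exact h ⟨h5, (hG.atMostOneOrEdge_iff (by omega)).2 hclique⟩
      exact hG.CC_eq_three h5 (hfull (by omega)) hy hz hyz hadj
    · by_cases h3 : Fintype.card V ≤ 3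
      · exact hG.CC_eq_three_of_card_le_three h3
      · exact absurd (hG.iso_cycleGraph_four (by omega) (hfull (by omega))) hC4
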